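/- For $n\ge 1$ let $\mathscr C_n$ be the set of $n$-cycles in the symmetric group $\mathscr S_n$ on $\{1,\dots,n\}$, equipped with the uniform probability measure. For a permutation $\nu\in\mathscr S_n$ let its degree (cyclic descent number) be $$\deg(\nu)=\#\{\,i : \nu(i)>\nu(i+1)\,\},$$ where $i$ ranges over $\{1,\dots,n\}$ and indices are taken modulo $n$ (so that $i=n$ is counted when $\nu(n)>\nu(1)$). Let $$\mu_n=\frac1{(n-1)!}\sum_{\nu\in\mathscr C_n}\deg(\nu),\qquad \sigma_n^2=\frac1{(n-1)!}\sum_{\nu\in\mathscr C_n}(\deg(\nu)-\mu_n)^2$$ be the mean and variance of the degree of a uniformly random $n$-cycle ($\sigma_n>0$ for all sufficiently large $n$), and let $$X_n=\frac{\deg|_{\mathscr C_n}-\mu_n}{\sigma_n}.$$ Then $X_n$ converges in distribution to the standard normal distribution $\mathcal N(0,1)$ as $n\to\infty$. -/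

import Mathlib

open MeasureTheory ProbabilityTheory Filter

/-- The degree (cyclic descent number) of a permutation `ν` of `n` points: the number of `i` with
`ν i > ν (i + 1)`, where `i` is taken modulo `n` (`finRotate n` is `i ↦ i + 1` modulo `n`). -/
def cyclicDegree {n : ℕ} (ν : Equiv.Perm (Fin n)) : ℕ :=
  (Finset.univ.filter fun i : Fin n => ν (finRotate n i) < ν i).card

/-- The set of `n`-cycles in the symmetric group on `n` points: the permutations having a single
cycle that passes through all the points. -/
abbrev NCycle (n : ℕ) : Type :=
  {ν : Equiv.Perm (Fin n) // ν.IsCycleOn Set.univ}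

instance NCycle.instMeasurableSpace (n : ℕ) : MeasurableSpace (NCycle n) := ⊤

instance NCycle.instDiscreteMeasurableSpace (n : ℕ) : DiscreteMeasurableSpace (NCycle n) :=
  ⟨fun _ => trivial⟩

instance NCycle.instNonempty (n : ℕ) : Nonempty (NCycle n) := by
  match n with
  | 0 => exact ⟨1, by simp; infer_instance⟩
  | 1 => exact ⟨1, by simp; infer_instance⟩
  | n + 2 =>
    refine ⟨finRotate (n + 2), ?_⟩
    have h := (isCycle_finRotate (n := n)).isCycleOn
    have hs : {x | finRotate (n + 2) x ≠ x} = Set.univ := by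
      ext x
      simp
    rwa [hs] at h

/-- The uniform probability measure on the set of `n`-cycles. -/
noncomputable def uniformNCycle (n : ℕ) : Measure (NCycle n) :=
  uniformOn Set.univ

instance uniformNCycle.instIsProbabilityMeasure (n : ℕ) :
    IsProbabilityMeasure (uniformNCycle n) :=
  isProbabilityMeasure_uniformOn Set.finite_univ Set.univ_nonempty

/-- The degree of an `n`-cycle as a real random variable. -/
def degreeRV (n : ℕ) (ν : NCycle n) : ℝ :=
  (cyclicDegree ν.1 : ℝ)

/-- The mean of the degree of a uniformly random `n`-cycle. -/
noncomputable def degreeMean (n : ℕ) : ℝ :=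
  ∫ ν, degreeRV n ν ∂(uniformNCycle n)

/-- The standard deviation of the degree of a uniformly random `n`-cycle. -/
noncomputable def degreeStdDev (n : ℕ) : ℝ :=
  Real.sqrt (variance (degreeRV n) (uniformNCycle n))

/-- The degree of a random `n`-cycle, normalized by its mean and standard deviation. -/
noncomputable def normalizedDegree (n : ℕ) (ν : NCycle n) : ℝ :=
  (degreeRV n ν - degreeMean n) / degreeStdDev n

/-! Let `V` be `n` independent uniform points of the circle ℝ/ℤ. Almost surely they are distinct,
and their ranks form a uniform permutation. The representative in [0, 1) of `V (i+1) - V i` is the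
difference of the representatives, plus 1 exactly at a descent; summed around the cycle the
differences cancel, so the number of cyclic descents equals the sum of these representatives
(`sum_circleRep_cyclic_sub`). The first `n - 1` differences are independent and uniform, and the
last term lies in [0, 1). The degree of a uniform permutation is thus a sum of i.i.d. variables up
to a bounded error, and the classical central limit theorem applies.

To pass to `n`-cycles, a uniform permutation and a uniform `n`-cycle are grown together by inserting
one point at a time (`exists_coupling_perm_nCycle`). The insertions differ only when the permutation
makes the new point fixed, which has probability 1/n at size n, so the two differ at O(log n) points
in L². Each such point changes the degree by at most 2, which is negligible against a standard
deviation of order √n. `tendsto_stdCharFun_of_variance_sub` absorbs both errors. -/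

/-! ### Standardized characteristic functions -/

section Standardization

variable {Ω Ω' : Type*} {mΩ : MeasurableSpace Ω} {mΩ' : MeasurableSpace Ω'}
  {P : Measure Ω} {Q : Measure Ω'} {X Y : Ω → ℝ}

/-- The random variable `X` centered at its mean and divided by its standard deviation. -/
noncomputable def standardize (P : Measure Ω) (X : Ω → ℝ) (ω : Ω) : ℝ :=
  (X ω - ∫ ω, X ω ∂P) / √(variance X P)

/-- The characteristic function of the standardization of `X`. -/
noncomputable def stdCharFun (P : Measure Ω) (X : Ω → ℝ) (t : ℝ) : ℂ :=
  charFun (P.map (standardize P X)) t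

theorem stdCharFun_congr {Z : Ω' → ℝ} (h : IdentDistrib X Z P Q) (t : ℝ) :
    stdCharFun P X t = stdCharFun Q Z t := by
  have hu : Measurable fun x : ℝ ↦ (x - ∫ ω, X ω ∂P) / √(variance X P) := by fun_prop
  have key := (h.comp hu).map_eq
  have h1 : standardize P X = (fun x : ℝ ↦ (x - ∫ ω, X ω ∂P) / √(variance X P)) ∘ X := rfl
  have h2 : standardize Q Z = (fun x : ℝ ↦ (x - ∫ ω, X ω ∂P) / √(variance X P)) ∘ Z := by
    funext ω
    simp only [standardize, Function.comp_apply, h.integral_eq, h.variance_eq]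
  rw [stdCharFun, stdCharFun, h1, h2, key]

variable [IsProbabilityMeasure P]

/-- Var(X + cY) is a quadratic in c that is never negative, so its discriminant is at most 0. -/
theorem covariance_sq_le_variance_mul_variance (hX : MemLp X 2 P) (hY : MemLp Y 2 P) :
    covariance X Y P ^ 2 ≤ variance X P * variance Y P := by
  have h : ∀ c : ℝ, 0 ≤ variance Y P * (c * c) + (2 * covariance X Y P) * c + variance X P := by
    intro c
    have h0 := variance_nonneg (X + c • Y) P
    rw [variance_add hX (hY.const_smul c), variance_smul, covariance_smul_right] at h0
    linarith
  have := discrim_le_zero h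
  rw [discrim] at this
  nlinarith

theorem sqrt_variance_add_le (hX : MemLp X 2 P) (hY : MemLp Y 2 P) :
    √(variance (X + Y) P) ≤ √(variance X P) + √(variance Y P) := by
  apply Real.sqrt_le_iff.2 ⟨by positivity, ?_⟩
  rw [variance_add hX hY, add_sq, Real.sq_sqrt (variance_nonneg _ _),
    Real.sq_sqrt (variance_nonneg _ _)]
  have : covariance X Y P ≤ √(variance X P) * √(variance Y P) := by
    rw [← Real.sqrt_mul (variance_nonneg _ _)]
    exact Real.le_sqrt_of_sq_le (covariance_sq_le_variance_mul_variance hX hY)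
  linarith

theorem abs_sqrt_variance_sub_le (hX : MemLp X 2 P) (hY : MemLp Y 2 P) :
    |√(variance X P) - √(variance Y P)| ≤ √(variance (X - Y) P) := by
  have h1 := sqrt_variance_add_le hY (hX.sub hY)
  have h2 := sqrt_variance_add_le hX (hX.sub hY).neg
  rw [show Y + (X - Y) = X by simp] at h1
  rw [show X + -(X - Y) = Y by simp, variance_neg] at h2
  exact abs_sub_le_iff.2 ⟨by linarith, by linarith⟩

theorem integral_abs_sub_mean_le (hX : MemLp X 2 P) :
    ∫ ω, |X ω - ∫ ω, X ω ∂P| ∂P ≤ √(variance X P) := by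
  have hc : MemLp (fun ω ↦ |X ω - ∫ ω, X ω ∂P|) 2 P := (hX.sub (memLp_const _)).norm
  have h0 := variance_nonneg (fun ω ↦ |X ω - ∫ ω, X ω ∂P|) P
  rw [variance_eq_sub hc] at h0
  apply Real.le_sqrt_of_sq_le
  rw [variance_eq_integral hX.aestronglyMeasurable.aemeasurable]
  simpa using h0

theorem integral_abs_standardize_sub_le (hX : MemLp X 2 P) (hY : MemLp Y 2 P)
    (hpos : 0 < √(variance Y P)) :
    ∫ ω, |standardize P X ω - standardize P Y ω| ∂P ≤
      2 * √(variance (X - Y) P) / √(variance Y P) := by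
  set a := √(variance X P) with ha
  set b := √(variance Y P) with hb
  have hD := hX.sub hY
  have hXi := hX.integrable one_le_two
  have hYi := hY.integrable one_le_two
  have hDi := hD.integrable one_le_two
  have hpt : ∀ ω, |standardize P X ω - standardize P Y ω| ≤
      |a⁻¹ - b⁻¹| * |X ω - ∫ ω, X ω ∂P| + b⁻¹ * |(X - Y) ω - ∫ ω, (X - Y) ω ∂P| := by
    intro ω
    -- The difference of inverses multiplies the centered `X`, whose L¹ norm is at most `a`. Since
    -- |a⁻¹ - b⁻¹| a = |a - b| / b, only `b` has to be nonzero.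
    have : standardize P X ω - standardize P Y ω =
        (a⁻¹ - b⁻¹) * (X ω - ∫ ω, X ω ∂P) + b⁻¹ * ((X - Y) ω - ∫ ω, (X - Y) ω ∂P) := by
      simp only [standardize, Pi.sub_apply, integral_sub hXi hYi, ← ha, ← hb]
      ring
    rw [this]
    refine (abs_add_le _ _).trans ?_
    rw [abs_mul, abs_mul, abs_of_pos (inv_pos.2 hpos)]
  have hi1 : Integrable (fun ω ↦ |X ω - ∫ ω, X ω ∂P|) P := (hXi.sub (integrable_const _)).abs
  have hi2 : Integrable (fun ω ↦ |(X - Y) ω - ∫ ω, (X - Y) ω ∂P|) P :=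
    (hDi.sub (integrable_const _)).abs
  have h1 : |a⁻¹ - b⁻¹| * ∫ ω, |X ω - ∫ ω, X ω ∂P| ∂P ≤ √(variance (X - Y) P) / b := by
    refine (mul_le_mul_of_nonneg_left (integral_abs_sub_mean_le hX) (abs_nonneg _)).trans ?_
    rw [← ha]
    have ha0 : 0 ≤ a := Real.sqrt_nonneg _
    -- If `a = 0`, the product vanishes whatever the value of `a⁻¹`.
    rcases ha0.eq_or_lt with h | h
    · rw [← h, mul_zero]; positivity
    · have hab : |a⁻¹ - b⁻¹| * a = |a - b| / b := by
        rw [inv_sub_inv h.ne' hpos.ne', abs_div, abs_of_pos (mul_pos h hpos), abs_sub_comm]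
        field_simp
      rw [hab]
      exact div_le_div_of_nonneg_right (abs_sqrt_variance_sub_le hX hY) hpos.le
  have h2 : b⁻¹ * ∫ ω, |(X - Y) ω - ∫ ω, (X - Y) ω ∂P| ∂P ≤ √(variance (X - Y) P) / b := by
    rw [div_eq_inv_mul]
    exact mul_le_mul_of_nonneg_left (integral_abs_sub_mean_le hD) (inv_pos.2 hpos).le
  calc ∫ ω, |standardize P X ω - standardize P Y ω| ∂P
      ≤ ∫ ω, (|a⁻¹ - b⁻¹| * |X ω - ∫ ω, X ω ∂P| +
          b⁻¹ * |(X - Y) ω - ∫ ω, (X - Y) ω ∂P|) ∂P :=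
        integral_mono_of_nonneg (Eventually.of_forall fun _ ↦ abs_nonneg _)
          ((hi1.const_mul _).add (hi2.const_mul _)) (Eventually.of_forall hpt)
    _ = |a⁻¹ - b⁻¹| * ∫ ω, |X ω - ∫ ω, X ω ∂P| ∂P +
          b⁻¹ * ∫ ω, |(X - Y) ω - ∫ ω, (X - Y) ω ∂P| ∂P := by
        rw [integral_add (hi1.const_mul _) (hi2.const_mul _), integral_const_mul,
          integral_const_mul]
    _ ≤ 2 * √(variance (X - Y) P) / b := by
        rw [two_mul, add_div]
        exact add_le_add h1 h2

theorem norm_charFun_map_sub_le (hX : Integrable X P) (hY : Integrable Y P) (t : ℝ) :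
    ‖charFun (P.map X) t - charFun (P.map Y) t‖ ≤ |t| * ∫ ω, |X ω - Y ω| ∂P := by
  have hXm := hX.aestronglyMeasurable.aemeasurable
  have hYm := hY.aestronglyMeasurable.aemeasurable
  have hint : ∀ {Z : Ω → ℝ}, AEMeasurable Z P →
      Integrable (fun ω ↦ Complex.exp ((t : ℂ) * (Z ω : ℂ) * Complex.I)) P := by
    intro Z hZ
    refine Integrable.of_bound (C := 1) ?_ (Eventually.of_forall fun ω ↦ ?_)
    · exact AEMeasurable.aestronglyMeasurable (by fun_prop)
    · rw [← Complex.ofReal_mul, Complex.norm_exp_ofReal_mul_I]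
  rw [charFun_apply_real, charFun_apply_real,
    integral_map hXm (by fun_prop), integral_map hYm (by fun_prop),
    ← integral_sub (hint hXm) (hint hYm), ← integral_const_mul]
  refine norm_integral_le_of_norm_le ((hX.sub hY).abs.const_mul _)
    (Eventually.of_forall fun ω ↦ ?_)
  have h1 : Complex.exp ((t : ℂ) * (X ω : ℂ) * Complex.I) -
      Complex.exp ((t : ℂ) * (Y ω : ℂ) * Complex.I) =
      Complex.exp (((t * Y ω : ℝ) : ℂ) * Complex.I) *
        (Complex.exp (Complex.I * ((t * (X ω - Y ω) : ℝ) : ℂ)) - 1) := by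
    rw [mul_sub, ← Complex.exp_add, mul_one]
    push_cast
    ring_nf
  rw [h1, norm_mul, Complex.norm_exp_ofReal_mul_I, one_mul]
  refine (Real.norm_exp_I_mul_ofReal_sub_one_le).trans ?_
  rw [Real.norm_eq_abs, abs_mul]

theorem norm_stdCharFun_sub_le (hX : MemLp X 2 P) (hY : MemLp Y 2 P)
    (hpos : 0 < √(variance Y P)) (t : ℝ) :
    ‖stdCharFun P X t - stdCharFun P Y t‖ ≤
      |t| * (2 * √(variance (X - Y) P) / √(variance Y P)) := by
  have hs : ∀ {Z : Ω → ℝ}, MemLp Z 2 P → Integrable (standardize P Z) P := fun hZ ↦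
    ((hZ.integrable one_le_two).sub (integrable_const _)).div_const _
  exact (norm_charFun_map_sub_le (hs hX) (hs hY) t).trans
    (mul_le_mul_of_nonneg_left (integral_abs_standardize_sub_le hX hY hpos) (abs_nonneg t))

end Standardization

/-- Asymptotic normality is stable under perturbations that are small in `L²` relative to the
standard deviation. -/
theorem tendsto_stdCharFun_of_variance_sub {Ω : ℕ → Type*} {mΩ : ∀ n, MeasurableSpace (Ω n)}
    {P : ∀ n, Measure (Ω n)} [∀ n, IsProbabilityMeasure (P n)] {X Y : ∀ n, Ω n → ℝ}
    (hX : ∀ n, MemLp (X n) 2 (P n)) (hY : ∀ n, MemLp (Y n) 2 (P n))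
    (hpos : ∀ᶠ n in atTop, 0 < √(variance (Y n) (P n)))
    (hsmall : Tendsto (fun n ↦ √(variance (X n - Y n) (P n)) / √(variance (Y n) (P n)))
      atTop (nhds 0)) {t : ℝ} {z : ℂ}
    (h : Tendsto (fun n ↦ stdCharFun (P n) (Y n) t) atTop (nhds z)) :
    Tendsto (fun n ↦ stdCharFun (P n) (X n) t) atTop (nhds z) := by
  have hd : Tendsto (fun n ↦ stdCharFun (P n) (X n) t - stdCharFun (P n) (Y n) t) atTop
      (nhds 0) := by
    refine squeeze_zero_norm' (a := fun n ↦ |t| *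
      (2 * (√(variance (X n - Y n) (P n)) / √(variance (Y n) (P n))))) ?_ ?_
    · filter_upwards [hpos] with n hn
      refine (norm_stdCharFun_sub_le (hX n) (hY n) hn t).trans_eq ?_
      rw [mul_div_assoc]
    · simpa using (hsmall.const_mul 2).const_mul |t|
  simpa using hd.add h

/-! ### Coupling a uniform permutation with a uniform `n`-cycle -/

section Coupling

open Equiv Equiv.Perm
open scoped BigOperators

theorem Equiv.Perm.SameCycle.of_forall_step {α β : Type*} {f : Perm α} {e : Perm β} {π : α → β}
    (h : ∀ z, e.SameCycle (π z) (π (f z))) {z w : α} (hzw : f.SameCycle z w) :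
    e.SameCycle (π z) (π w) := by
  obtain ⟨i, rfl⟩ := hzw
  induction i with
  | zero => exact SameCycle.refl _ _
  | succ k ih =>
    rw [add_comm, zpow_add, zpow_one, mul_apply]
    exact ih.trans (h _)
  | pred k ih =>
    have hk : (f ^ (-(k : ℤ))) z = f ((f ^ (-(k : ℤ) - 1)) z) := by
      rw [← mul_apply, ← zpow_one_add]
      congr 2
      ring
    rw [hk] at ih
    exact ih.trans (h _).symm

theorem isCycleOn_univ_iff {α : Type*} {f : Perm α} :
    f.IsCycleOn Set.univ ↔ ∀ x y, f.SameCycle x y :=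
  ⟨fun h x y ↦ h.2 (Set.mem_univ x) (Set.mem_univ y),
    fun h ↦ ⟨Set.bijOn_univ.2 f.bijective, fun x _ y _ ↦ h x y⟩⟩

/-- `decomposeFin.symm (q.succ, e)` splices the new point 0 into the arrow of `e` that ends at `q`,
which neither merges nor splits cycles. -/
theorem isCycleOn_univ_decomposeFin_symm_iff {n : ℕ} (q : Fin n) (e : Perm (Fin n)) :
    (decomposeFin.symm (q.succ, e)).IsCycleOn Set.univ ↔ e.IsCycleOn Set.univ := by
  set f := decomposeFin.symm (q.succ, e) with hf
  have hf0 : f 0 = q.succ := decomposeFin_symm_apply_zero _ _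
  have hfs : ∀ x : Fin n, f x.succ = if e x = q then 0 else (e x).succ := by
    intro x
    rw [hf, decomposeFin_symm_apply_succ]
    split_ifs with h
    · rw [h, swap_apply_right]
    · exact swap_apply_of_ne_of_ne (Fin.succ_ne_zero _) (fun h' ↦ h (Fin.succ_injective _ h'))
  rw [isCycleOn_univ_iff, isCycleOn_univ_iff]
  constructor
  · intro h x y
    -- This `π` collapses the new point 0 onto `q`.
    have key := SameCycle.of_forall_step (f := f) (e := e)
      (π := fun z ↦ Fin.cases (motive := fun _ ↦ Fin n) q id z) (fun z ↦ ?_) (h x.succ y.succ)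
    · simpa using key
    · refine Fin.cases ?_ (fun x ↦ ?_) z
      · rw [hf0]
        exact SameCycle.refl _ _
      · rw [hfs]
        split_ifs with hx
        · exact hx ▸ sameCycle_apply_right.2 (SameCycle.refl _ _)
        · exact sameCycle_apply_right.2 (SameCycle.refl _ _)
  · intro h
    have hsucc : ∀ x y : Fin n, f.SameCycle x.succ y.succ := fun x y ↦
      SameCycle.of_forall_step (f := e) (e := f) (π := Fin.succ) (fun z ↦ by
        -- The arrow into `q` becomes two steps of `f`, passing through 0.
        by_cases hz : e z = q
        · have : (e z).succ = f (f z.succ) := by rw [hfs, if_pos hz, hf0, hz]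
          rw [this]
          exact sameCycle_apply_right.2 (sameCycle_apply_right.2 (SameCycle.refl _ _))
        · have : (e z).succ = f z.succ := by rw [hfs, if_neg hz]
          rw [this]
          exact sameCycle_apply_right.2 (SameCycle.refl _ _)) (h x y)
    have hzero : f.SameCycle 0 q.succ := hf0 ▸ sameCycle_apply_right.2 (SameCycle.refl _ _)
    have hall : ∀ x, f.SameCycle x q.succ := fun x ↦
      Fin.cases (motive := fun x ↦ f.SameCycle x q.succ) hzero (fun x ↦ hsucc x q) x
    exact fun x y ↦ (hall x).trans (hall y).symm

noncomputable instance NCycle.instFintype (n : ℕ) : Fintype (NCycle n) := Fintype.ofFinite _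

/-- Insert a new point `0` into an `n`-cycle on the remaining points, just before `q`. -/
def NCycle.insert {n : ℕ} (x : Fin n × NCycle n) : NCycle (n + 1) :=
  ⟨decomposeFin.symm (x.1.succ, x.2.1),
    (isCycleOn_univ_decomposeFin_symm_iff _ _).2 x.2.2⟩

theorem NCycle.insert_bijective (n : ℕ) :
    Function.Bijective (NCycle.insert : Fin (n + 1) × NCycle (n + 1) → NCycle (n + 2)) := by
  constructor
  · rintro ⟨q, ν⟩ ⟨q', ν'⟩ h
    have := decomposeFin.symm.injective (congrArg Subtype.val h)
    simpa [Subtype.ext_iff] using this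
  · rintro ⟨ν, hν⟩
    obtain ⟨⟨p, e⟩, rfl⟩ := decomposeFin.symm.surjective ν
    -- With `p = 0` the point 0 would be fixed, impossible in a cycle that also contains 1.
    have hp : p ≠ 0 := by
      rintro rfl
      have h0 := isCycleOn_univ_iff.1 hν 0 1
      rw [SameCycle] at h0
      obtain ⟨i, hi⟩ := h0
      rw [zpow_apply_eq_self_of_apply_eq_self (decomposeFin_symm_apply_zero _ _)] at hi
      exact zero_ne_one hi
    obtain ⟨q, rfl⟩ := Fin.exists_succ_eq.2 hp
    exact ⟨(q, ⟨e, (isCycleOn_univ_decomposeFin_symm_iff _ _).1 hν⟩), rfl⟩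

theorem hammingDist_decomposeFin_symm {n : ℕ} (p : Fin (n + 1)) (e e' : Perm (Fin n)) :
    hammingDist (decomposeFin.symm (p, e)) (decomposeFin.symm (p, e')) = hammingDist e e' := by
  simp [hammingDist, Fin.card_filter_univ_succ]

/-- The only new disagreements are at 0 and at the point that `e'` sends to `q`. -/
theorem hammingDist_decomposeFin_symm_zero_le {n : ℕ} (q : Fin n) (e e' : Perm (Fin n)) :
    hammingDist (decomposeFin.symm (0, e)) (decomposeFin.symm (q.succ, e')) ≤
      hammingDist e e' + 2 := by
  have hsub : (Finset.univ.filter fun x : Fin n ↦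
      decomposeFin.symm (0, e) x.succ ≠ decomposeFin.symm (q.succ, e') x.succ) ⊆
      insert (e'.symm q) (Finset.univ.filter fun x : Fin n ↦ e x ≠ e' x) := by
    intro x hx
    simp only [Finset.mem_filter, Finset.mem_univ, true_and, decomposeFin_symm_apply_succ,
      Finset.mem_insert] at hx ⊢
    by_contra! hc
    apply hx
    rw [hc.2, swap_self, swap_apply_of_ne_of_ne (Fin.succ_ne_zero _)]
    · rfl
    · intro h
      exact hc.1 ((Equiv.eq_symm_apply _).2 (Fin.succ_injective _ h))
  have hle := (Finset.card_le_card hsub).trans (Finset.card_insert_le _ _)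
  simp only [hammingDist]
  rw [Fin.card_filter_univ_succ]
  split_ifs <;> omega

/-- Whether `i` is a descent depends only on the values at `i` and its successor, so each point of
disagreement affects at most two positions. -/
theorem cyclicDegree_le_add_hammingDist {n : ℕ} (σ ν : Perm (Fin n)) :
    cyclicDegree σ ≤ cyclicDegree ν + 2 * hammingDist σ ν := by
  classical
  set D := Finset.univ.filter fun i : Fin n ↦ σ i ≠ ν i with hD
  have hsub : (Finset.univ.filter fun i : Fin n ↦ σ (finRotate n i) < σ i) ⊆
      (Finset.univ.filter fun i : Fin n ↦ ν (finRotate n i) < ν i) ∪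
        (D ∪ D.map (finRotate n).symm.toEmbedding) := by
    intro i hi
    by_contra! hc
    simp only [hD, Finset.mem_union, Finset.mem_filter, Finset.mem_univ, true_and,
      Finset.mem_map_equiv, Equiv.symm_symm, not_or, not_not] at hi hc
    rw [hc.2.1, hc.2.2] at hi
    exact hc.1 hi
  have h1 := (Finset.card_le_card hsub).trans (Finset.card_union_le _ _)
  have h2 := Finset.card_union_le D (D.map (finRotate n).symm.toEmbedding)
  rw [Finset.card_map] at h2
  have h3 : hammingDist (σ : Fin n → Fin n) ν = D.card := rfl
  simp only [cyclicDegree, h3]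
  omega

theorem abs_cyclicDegree_sub_le {n : ℕ} (σ ν : Perm (Fin n)) :
    |(cyclicDegree ν : ℝ) - cyclicDegree σ| ≤ 2 * hammingDist σ ν := by
  have h1 := cyclicDegree_le_add_hammingDist σ ν
  have h2 := cyclicDegree_le_add_hammingDist ν σ
  rw [hammingDist_comm] at h2
  rw [abs_sub_le_iff, sub_le_iff_le_add', sub_le_iff_le_add']
  exact ⟨by exact_mod_cast h2, by exact_mod_cast h1⟩

theorem expect_prod {α β : Type*} [Fintype α] [Fintype β] (f : α × β → ℝ) :
    𝔼 x, f x = 𝔼 a, 𝔼 b, f (a, b) := by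
  rw [← Finset.univ_product_univ, Finset.expect_product]

/-- `q` if `p = 0`, and the predecessor of `p` otherwise. -/
def predOr {n : ℕ} (p : Fin (n + 1)) (q : Fin n) : Fin n :=
  Fin.cases (motive := fun _ ↦ Fin n) q id p

/-- For uniform independent `p` and `q`, `predOr p q` is again uniform: this makes the coupled cycle
uniform while letting it follow `p` whenever `p ≠ 0`. -/
theorem expect_predOr {n : ℕ} (h : Fin (n + 1) → ℝ) :
    𝔼 p : Fin (n + 2), 𝔼 q, h (predOr p q) = 𝔼 q, h q := by
  rw [Fintype.expect_eq_sum_div_card, Fin.sum_univ_succ]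
  simp only [predOr, Fin.cases_zero, Fin.cases_succ, id, Fintype.expect_const]
  rw [Fintype.expect_eq_sum_div_card]
  simp only [Fintype.card_fin]
  push_cast
  field_simp
  ring

theorem hammingDist_insert_le {n : ℕ} (p : Fin (n + 1)) (q : Fin n) (e : Perm (Fin n))
    (ν : NCycle n) :
    (hammingDist (decomposeFin.symm (p, e)) (NCycle.insert (predOr p q, ν)).1 : ℝ) ≤
      hammingDist e ν.1 + 2 * if p = 0 then 1 else 0 := by
  revert p
  refine Fin.cases ?_ fun p ↦ ?_
  · simpa [NCycle.insert, predOr] using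
      (Nat.cast_le (α := ℝ)).2 (hammingDist_decomposeFin_symm_zero_le q e ν.1)
  · simp [NCycle.insert, predOr, hammingDist_decomposeFin_symm]

/-- A uniform permutation and a uniform `n`-cycle can be coupled so that the number of points at
which they differ is of logarithmic order in `L²`. -/
theorem exists_coupling_perm_nCycle (m : ℕ) :
    ∃ (Ω : Type) (_ : Fintype Ω) (_ : Nonempty Ω) (s : Ω → Perm (Fin (m + 1)))
      (c : Ω → NCycle (m + 1)),
      (∀ g : Perm (Fin (m + 1)) → ℝ, 𝔼 ω, g (s ω) = 𝔼 σ, g σ) ∧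
      (∀ g : NCycle (m + 1) → ℝ, 𝔼 ω, g (c ω) = 𝔼 ν, g ν) ∧
      𝔼 ω, (hammingDist (s ω) (c ω).1 : ℝ) ≤ 2 * harmonic (m + 1) ∧
      𝔼 ω, (hammingDist (s ω) (c ω).1 : ℝ) ^ 2 ≤ 4 * (harmonic (m + 1) + 1) ^ 2 := by
  induction m with
  | zero =>
    have hsub : Subsingleton (NCycle (0 + 1)) :=
      ⟨fun a b ↦ Subtype.ext (Subsingleton.elim (α := Perm (Fin 1)) _ _)⟩
    let ν₀ : NCycle (0 + 1) := Classical.arbitrary _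
    have hu : ∀ {A : Type} [Fintype A] [Subsingleton A] (a : A) (g : A → ℝ),
        𝔼 _ω : Unit, g a = 𝔼 x, g x := by
      intro A _ _ a g
      have : Nonempty A := ⟨a⟩
      have h1 : ∀ x, g x = g a := fun x ↦ congrArg g (Subsingleton.elim _ _)
      simp only [h1, Fintype.expect_const]
    have : Subsingleton (Perm (Fin (0 + 1))) := inferInstanceAs (Subsingleton (Perm (Fin 1)))
    have hd : hammingDist ((1 : Perm (Fin (0 + 1))) : Fin (0 + 1) → Fin (0 + 1)) ν₀.1 = 0 := by
      rw [hammingDist_eq_zero]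
      exact funext fun i ↦ Subsingleton.elim (α := Fin 1) _ _
    refine ⟨Unit, inferInstance, inferInstance, fun _ ↦ 1, fun _ ↦ ν₀, hu _, hu _, ?_, ?_⟩
    · simp only [hd, Nat.cast_zero, Fintype.expect_const]
      simp [harmonic]
    · simp only [hd, Nat.cast_zero, ne_eq, OfNat.ofNat_ne_zero, not_false_eq_true, zero_pow,
        Fintype.expect_const]
      positivity
  | succ m ih =>
    obtain ⟨Ω, _, _, s, c, hs, hc, h1, h2⟩ := ih
    have hH : ((harmonic (m + 1 + 1) : ℚ) : ℝ) = harmonic (m + 1) + 1 / (m + 2) := by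
      rw [harmonic_succ]
      push_cast
      ring
    -- `b` is the indicator of `p = 0`, kept opaque so that `simp` only pulls it out of averages.
    obtain ⟨b, hb⟩ : ∃ b : Fin (m + 1 + 1) → ℝ, ∀ p, b p = if p = 0 then 1 else 0 :=
      ⟨_, fun _ ↦ rfl⟩
    have hind : 𝔼 p, b p = 1 / (m + 2) := by
      rw [Fintype.expect_eq_sum_div_card]
      simp [hb]
      ring
    have hle : ∀ x : Ω × Fin (m + 1 + 1) × Fin (m + 1),
        (hammingDist (decomposeFin.symm (x.2.1, s x.1))
          (NCycle.insert (predOr x.2.1 x.2.2, c x.1)).1 : ℝ) ≤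
        hammingDist (s x.1) (c x.1).1 + 2 * b x.2.1 := fun x ↦
      hb x.2.1 ▸ hammingDist_insert_le _ _ _ _
    refine ⟨Ω × Fin (m + 1 + 1) × Fin (m + 1), inferInstance, inferInstance,
      fun x ↦ decomposeFin.symm (x.2.1, s x.1),
      fun x ↦ NCycle.insert (predOr x.2.1 x.2.2, c x.1), fun g ↦ ?_, fun g ↦ ?_, ?_, ?_⟩
    · rw [expect_prod]
      simp only [expect_prod, Fintype.expect_const]
      rw [Finset.expect_comm]
      have : ∀ p, 𝔼 ω, g (decomposeFin.symm (p, s ω)) = 𝔼 σ, g (decomposeFin.symm (p, σ)) :=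
        fun p ↦ hs fun σ ↦ g (decomposeFin.symm (p, σ))
      simp only [this]
      rw [← expect_prod (fun x ↦ g (decomposeFin.symm x))]
      exact Fintype.expect_equiv decomposeFin.symm _ _ fun _ ↦ rfl
    · rw [expect_prod]
      simp only [expect_prod]
      have hin : ∀ ω, 𝔼 p, 𝔼 q, g (NCycle.insert (predOr p q, c ω)) =
          𝔼 q, g (NCycle.insert (q, c ω)) := fun ω ↦ expect_predOr fun q ↦ g (NCycle.insert (q, c ω))
      simp only [hin]
      rw [Finset.expect_comm]
      have : ∀ q, 𝔼 ω, g (NCycle.insert (q, c ω)) = 𝔼 ν, g (NCycle.insert (q, ν)) :=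
        fun q ↦ hc fun ν ↦ g (NCycle.insert (q, ν))
      simp only [this]
      rw [← expect_prod (fun x ↦ g (NCycle.insert x))]
      exact Fintype.expect_bijective _ (NCycle.insert_bijective m) _ _ fun _ ↦ rfl
    · calc _ ≤ 𝔼 x : Ω × Fin (m + 1 + 1) × Fin (m + 1),
            ((hammingDist (s x.1) (c x.1).1 : ℝ) + 2 * b x.2.1) :=
            Finset.expect_le_expect fun x _ ↦ hle x
        _ = 𝔼 ω, (hammingDist (s ω) (c ω).1 : ℝ) + 2 * (1 / (m + 2)) := by
            rw [expect_prod]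
            simp only [expect_prod, Fintype.expect_const, Finset.expect_add_distrib,
              ← Finset.mul_expect, hind]
        _ ≤ _ := by rw [hH]; linarith
    -- Expanding the square uses `b ^ 2 = b`; the cross term then factors by independence of `p` and
    -- is controlled by the first-moment bound.
    · have hpt : ∀ x : Ω × Fin (m + 1 + 1) × Fin (m + 1),
          (hammingDist (decomposeFin.symm (x.2.1, s x.1))
            (NCycle.insert (predOr x.2.1 x.2.2, c x.1)).1 : ℝ) ^ 2 ≤
          (hammingDist (s x.1) (c x.1).1 : ℝ) ^ 2 +
            (4 * (hammingDist (s x.1) (c x.1).1 : ℝ) + 4) * b x.2.1 := by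
        intro x
        refine (pow_le_pow_left₀ (Nat.cast_nonneg _) (hle x) 2).trans_eq ?_
        rw [hb]
        split_ifs <;> ring
      calc _ ≤ 𝔼 x : Ω × Fin (m + 1 + 1) × Fin (m + 1),
            ((hammingDist (s x.1) (c x.1).1 : ℝ) ^ 2 +
            (4 * (hammingDist (s x.1) (c x.1).1 : ℝ) + 4) * b x.2.1) :=
            Finset.expect_le_expect fun x _ ↦ hpt x
        _ = 𝔼 ω, (hammingDist (s ω) (c ω).1 : ℝ) ^ 2 +
              (4 * 𝔼 ω, (hammingDist (s ω) (c ω).1 : ℝ) + 4) * (1 / (m + 2)) := by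
            rw [expect_prod]
            simp only [expect_prod, Fintype.expect_const, Finset.expect_add_distrib,
              ← Finset.mul_expect, ← Finset.expect_mul, hind]
        _ ≤ 4 * (harmonic (m + 1) + 1) ^ 2 +
              (4 * (2 * harmonic (m + 1)) + 4) * (1 / (m + 2)) := by gcongr
        _ ≤ _ := by
            rw [hH]
            have : (0 : ℝ) < 1 / (m + 2) := by positivity
            nlinarith

end Coupling

/-! ### Cyclic descents of independent uniform points of the circle -/

section Circle

open scoped BigOperators

instance UnitAddCircle.instIsProbabilityMeasureVolume :
    IsProbabilityMeasure (volume : Measure UnitAddCircle) :=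
  ⟨UnitAddCircle.measure_univ⟩

instance UnitAddCircle.instNullSingletonClassVolume :
    NullSingletonClass (volume : Measure UnitAddCircle) := by
  refine ⟨fun x ↦ ?_⟩
  have h := AddCircle.volume_closedBall (T := 1) (x := x) 0
  rw [Metric.closedBall_zero] at h
  simpa using h

/-- The representative in `[0, 1)` of a point of the circle `ℝ / ℤ`. -/
noncomputable def circleRep (x : UnitAddCircle) : ℝ := (AddCircle.equivIco 1 0 x : ℝ)

theorem circleRep_mem (x : UnitAddCircle) : circleRep x ∈ Set.Ico (0 : ℝ) 1 := by
  have h := (AddCircle.equivIco (1 : ℝ) 0 x).2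
  exact ⟨h.1, h.2.trans_eq (zero_add 1)⟩

theorem coe_circleRep (x : UnitAddCircle) : (circleRep x : UnitAddCircle) = x :=
  AddCircle.coe_equivIco

theorem circleRep_injective : Function.Injective circleRep :=
  Function.LeftInverse.injective (g := fun x : ℝ ↦ (x : UnitAddCircle)) coe_circleRep

theorem circleRep_coe {x : ℝ} (hx : x ∈ Set.Ico (0 : ℝ) 1) : circleRep (x : UnitAddCircle) = x := by
  have hx' : x ∈ Set.Ico (0 : ℝ) (0 + 1) := by simpa using hx
  exact congrArg Subtype.val (AddCircle.equivIco_coe_eq (p := (1 : ℝ)) (a := 0) hx')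

@[fun_prop]
theorem measurable_circleRep : Measurable circleRep :=
  measurable_subtype_coe.comp (AddCircle.measurableEquivIco 1 0).measurable

theorem circleRep_sub (a b : UnitAddCircle) :
    circleRep (b - a) =
      circleRep b - circleRep a + if circleRep b < circleRep a then 1 else 0 := by
  have ha := circleRep_mem a
  have hb := circleRep_mem b
  have hcoe : ((circleRep b - circleRep a +
      if circleRep b < circleRep a then 1 else 0 : ℝ) : UnitAddCircle) = b - a := by
    have h1 : ((if circleRep b < circleRep a then 1 else 0 : ℝ) : UnitAddCircle) = 0 := by
      split_ifs
      · exact AddCircle.coe_period 1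
      · rfl
    rw [AddCircle.coe_add, AddCircle.coe_sub, h1, coe_circleRep, coe_circleRep, add_zero]
  rw [← hcoe]
  apply circleRep_coe
  split_ifs with h
  · exact ⟨by linarith [ha.2, hb.1], by linarith⟩
  · exact ⟨by linarith [not_lt.1 h], by linarith [ha.1, hb.2]⟩

theorem memLp_circleRep : MemLp circleRep 2 volume :=
  MemLp.of_bound measurable_circleRep.aestronglyMeasurable 1 (Eventually.of_forall fun x ↦ by
    rw [Real.norm_of_nonneg (circleRep_mem x).1]
    exact (circleRep_mem x).2.le)

/-- Zero variance would make an injective function almost surely constant, giving an atom of mass 1.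
The exact value is never needed. -/
theorem variance_circleRep_pos : 0 < variance circleRep volume := by
  refine (variance_nonneg _ _).lt_of_ne' fun h ↦ ?_
  have h1 := ae_eq_integral_of_variance_eq_zero memLp_circleRep h
  have hs : {x | circleRep x = ∫ x, circleRep x}.Subsingleton := fun x hx y hy ↦
    circleRep_injective (hx.trans hy.symm)
  have h2 : volume {x | circleRep x = ∫ x, circleRep x} = 1 := by
    rw [measure_congr (eventuallyEq_univ.2 h1)]
    exact measure_univ
  rw [hs.measure_zero volume] at h2
  exact zero_ne_one h2

theorem variance_sum_circleRep (m : ℕ) :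
    variance (fun u : Fin m → UnitAddCircle ↦ ∑ i, circleRep (u i)) volume =
      m * variance circleRep volume := by
  have h := variance_sum_pi (ι := Fin m) (μ := fun _ ↦ (volume : Measure UnitAddCircle))
    (X := fun _ ↦ circleRep) fun _ ↦ memLp_circleRep
  rw [← volume_pi] at h
  rw [← Finset.sum_fn, h]
  simp

theorem integral_sum_circleRep (m : ℕ) :
    ∫ u : Fin m → UnitAddCircle, ∑ i, circleRep (u i) = m * ∫ x, circleRep x := by
  have he : ∀ i : Fin m, MeasurePreserving (fun u : Fin m → UnitAddCircle ↦ u i) :=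
    fun i ↦ measurePreserving_eval (fun _ ↦ volume) i
  rw [integral_finsetSum]
  · have : ∀ i : Fin m, ∫ u : Fin m → UnitAddCircle, circleRep (u i) = ∫ x, circleRep x :=
      fun i ↦ by
        rw [← (he i).map_eq, integral_map (he i).measurable.aemeasurable
          measurable_circleRep.aestronglyMeasurable]
    simp [this]
  · exact fun i _ ↦ (he i).integrable_comp_of_integrable (memLp_circleRep.integrable one_le_two)

theorem tendsto_stdCharFun_sum_circleRep (t : ℝ) :
    Tendsto (fun m : ℕ ↦ stdCharFun (volume : Measure (Fin m → UnitAddCircle))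
      (fun u ↦ ∑ i, circleRep (u i)) t) atTop (nhds (Complex.exp (-t ^ 2 / 2))) := by
  set Z : UnitAddCircle → ℝ := standardize volume circleRep with hZ
  have hv := variance_circleRep_pos
  have hZm : Measurable Z := (measurable_circleRep.sub_const _).div_const _
  have h0 : ∫ x, Z x = 0 := by
    simp only [hZ, standardize]
    rw [integral_div, integral_sub (memLp_circleRep.integrable one_le_two) (integrable_const _)]
    simp
  have h1 : ∫ x, (Z ^ 2) x = 1 := by
    simp only [hZ, standardize, Pi.pow_apply, div_pow]
    rw [integral_div, ← variance_eq_integral measurable_circleRep.aemeasurable,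
      Real.sq_sqrt hv.le, div_self hv.ne']
  refine (tendsto_charFun_inv_sqrt_mul_pow hZm.aemeasurable h0 h1 t).congr fun m ↦ ?_
  have hstd : standardize (volume : Measure (Fin m → UnitAddCircle))
      (fun u ↦ ∑ i, circleRep (u i)) = fun u ↦ (√m)⁻¹ * ∑ i, Z (u i) := by
    funext u
    simp only [standardize, hZ, variance_sum_circleRep, integral_sum_circleRep]
    rw [← Finset.sum_div, Finset.sum_sub_distrib, Real.sqrt_mul (Nat.cast_nonneg m)]
    simp only [Finset.sum_const, Finset.card_univ, Fintype.card_fin, nsmul_eq_mul]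
    rw [← div_eq_inv_mul, div_div, mul_comm (√_) (√(m : ℝ))]
  have hind : iIndepFun (fun (i : Fin m) (u : Fin m → UnitAddCircle) ↦ Z (u i)) volume :=
    iIndepFun_pi (X := fun _ ↦ Z) fun _ ↦ hZm.aemeasurable
  have hmap : ∀ i : Fin m, (volume : Measure (Fin m → UnitAddCircle)).map (fun u ↦ Z (u i)) =
      (volume : Measure UnitAddCircle).map Z := fun i ↦ by
    have he : MeasurePreserving (fun u : Fin m → UnitAddCircle ↦ u i) := measurePreserving_eval (fun _ ↦ volume) i
    rw [← he.map_eq, Measure.map_map hZm he.measurable]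
    rfl
  have hmi : ∀ i : Fin m, Measurable fun u : Fin m → UnitAddCircle ↦ Z (u i) := fun i ↦
    hZm.comp (measurable_pi_apply i)
  rw [stdCharFun, hstd,
    charFun_map_mul_comp (Finset.measurable_sum _ fun i _ ↦ hmi i).aemeasurable,
    hind.charFun_map_fun_sum_eq_prod fun i ↦ (hmi i).aemeasurable]
  simp [hmap]

/-- A continuous surjective homomorphism of compact groups carries Haar measure to Haar measure;
both sides have total mass 1. -/
theorem measurePreserving_of_surjective_hom {k l : ℕ}
    (f : (Fin k → UnitAddCircle) →+ (Fin l → UnitAddCircle)) (hc : Continuous f)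
    (hs : Function.Surjective f) : MeasurePreserving f :=
  f.measurePreserving hc hs (by simp)

/-- The differences of consecutive entries. -/
def consecutiveDiff (m : ℕ) : (Fin (m + 1) → UnitAddCircle) →+ (Fin m → UnitAddCircle) where
  toFun V i := V i.succ - V i.castSucc
  map_zero' := by
    funext i
    simp
  map_add' V W := by
    funext i
    simp only [Pi.add_apply]
    abel

theorem measurePreserving_consecutiveDiff (m : ℕ) : MeasurePreserving (consecutiveDiff m) := by
  refine measurePreserving_of_surjective_hom _ ?_ fun u ↦ ⟨Fin.partialSum u, ?_⟩
  · change Continuous fun (V : Fin (m + 1) → UnitAddCircle) (i : Fin m) ↦ V i.succ - V i.castSucc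
    fun_prop
  · funext i
    change Fin.partialSum u i.succ - Fin.partialSum u i.castSucc = u i
    rw [Fin.partialSum_succ, add_sub_cancel_left]

theorem measurePreserving_comp_perm {n : ℕ} (σ : Equiv.Perm (Fin n)) :
    MeasurePreserving fun V : Fin n → UnitAddCircle ↦ V ∘ σ :=
  measurePreserving_of_surjective_hom
    { toFun := fun V : Fin n → UnitAddCircle ↦ V ∘ σ
      map_zero' := rfl
      map_add' := fun _ _ ↦ rfl }
    (by
      change Continuous fun (V : Fin n → UnitAddCircle) (i : Fin n) ↦ V (σ i)
      fun_prop)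
    fun u ↦ ⟨u ∘ σ.symm, by
      funext i
      simp⟩

/-- For `i ≠ j` the difference `V i - V j` is Haar distributed, hence almost surely nonzero. -/
theorem ae_injective (n : ℕ) : ∀ᵐ V : Fin n → UnitAddCircle, Function.Injective V := by
  have h : ∀ i j : Fin n, i ≠ j → ∀ᵐ V : Fin n → UnitAddCircle, V i ≠ V j := by
    intro i j hij
    let f : (Fin n → UnitAddCircle) →+ UnitAddCircle :=
      { toFun := fun V ↦ V i - V j
        map_zero' := by simp
        map_add' := fun V W ↦ by
          simp only [Pi.add_apply]
          abel }
    have hf : MeasurePreserving f := f.measurePreserving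
      (by
        change Continuous fun V : Fin n → UnitAddCircle ↦ V i - V j
        fun_prop)
      (fun x ↦ ⟨Pi.single i x, by
        change (Pi.single i x : Fin n → UnitAddCircle) i -
          (Pi.single i x : Fin n → UnitAddCircle) j = x
        simp [hij.symm]⟩)
      (by simp)
    have h0 : ∀ᵐ x : UnitAddCircle, x ≠ 0 := by
      rw [ae_iff]
      simp
    filter_upwards [hf.quasiMeasurePreserving.ae h0] with V hV
    exact fun h ↦ hV (sub_eq_zero.2 h)
  have h' : ∀ᵐ V : Fin n → UnitAddCircle, ∀ i j : Fin n, i ≠ j → V i ≠ V j := by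
    rw [ae_all_iff]
    intro i
    rw [ae_all_iff]
    intro j
    by_cases hij : i = j
    · simp [hij]
    · filter_upwards [h i j hij] with V hV _ using hV
  filter_upwards [h'] with V hV i j hij
  by_contra hne
  exact hV i j hne hij

/-- The number of cyclic descents of a finite sequence of real numbers. -/
noncomputable def cyclicDescents {n : ℕ} (x : Fin n → ℝ) : ℕ :=
  (Finset.univ.filter fun i : Fin n ↦ x (finRotate n i) < x i).card

theorem cyclicDescents_eq_cyclicDegree {n : ℕ} {x : Fin n → ℝ} {ν : Equiv.Perm (Fin n)}
    (h : ∀ i j, x i < x j ↔ ν i < ν j) : cyclicDescents x = cyclicDegree ν := by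
  simp only [cyclicDescents, cyclicDegree, h]

theorem exists_perm_lt_iff {n : ℕ} {x : Fin n → ℝ} (hx : Function.Injective x) :
    ∃ ρ : Equiv.Perm (Fin n), ∀ i j, x i < x j ↔ ρ i < ρ j := by
  refine ⟨(Tuple.sort x)⁻¹, fun i j ↦ ?_⟩
  have hm : StrictMono (x ∘ Tuple.sort x) :=
    (Tuple.monotone_sort x).strictMono_of_injective (hx.comp (Tuple.sort x).injective)
  have := hm.lt_iff_lt (a := (Tuple.sort x)⁻¹ i) (b := (Tuple.sort x)⁻¹ j)
  simpa using this

theorem expect_cyclicDescents_comp {n : ℕ} {x : Fin n → ℝ} (hx : Function.Injective x)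
    (g : ℕ → ℝ) :
    𝔼 σ : Equiv.Perm (Fin n), g (cyclicDescents (x ∘ σ)) =
      𝔼 σ : Equiv.Perm (Fin n), g (cyclicDegree σ) := by
  obtain ⟨ρ, hρ⟩ := exists_perm_lt_iff hx
  refine Fintype.expect_equiv (Equiv.mulLeft ρ) _ _ fun σ ↦ ?_
  rw [cyclicDescents_eq_cyclicDegree (x := x ∘ σ) (ν := ρ * σ) fun i j ↦ hρ (σ i) (σ j)]
  rfl

theorem measurable_cyclicDescents (n : ℕ) :
    Measurable fun V : Fin n → UnitAddCircle ↦ cyclicDescents (circleRep ∘ V) := by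
  simp only [cyclicDescents, Finset.card_filter]
  refine Finset.measurable_sum _ fun i _ ↦ Measurable.ite ?_ measurable_const measurable_const
  exact measurableSet_lt (by fun_prop) (by fun_prop)

/-- The law of `V` is invariant under permuting coordinates, so the integrand may be averaged over
all `σ`; for injective `V` that average no longer depends on `V`. -/
theorem integral_cyclicDescents (n : ℕ) {g : ℕ → ℝ} {C : ℝ} (hg : ∀ k, |g k| ≤ C) :
    ∫ V : Fin n → UnitAddCircle, g (cyclicDescents (circleRep ∘ V)) =
      𝔼 σ : Equiv.Perm (Fin n), g (cyclicDegree σ) := by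
  have hm : Measurable fun V : Fin n → UnitAddCircle ↦ g (cyclicDescents (circleRep ∘ V)) :=
    (measurable_of_countable g).comp (measurable_cyclicDescents n)
  have hσ : ∀ σ : Equiv.Perm (Fin n),
      ∫ V : Fin n → UnitAddCircle, g (cyclicDescents (circleRep ∘ V ∘ σ)) =
        ∫ V : Fin n → UnitAddCircle, g (cyclicDescents (circleRep ∘ V)) := fun σ ↦ by
    have h := measurePreserving_comp_perm σ
    conv_rhs => rw [← h.map_eq]
    rw [integral_map h.measurable.aemeasurable hm.aestronglyMeasurable]
  have hi : ∀ σ : Equiv.Perm (Fin n), Integrable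
      (fun V : Fin n → UnitAddCircle ↦ g (cyclicDescents (circleRep ∘ V ∘ σ))) := fun σ ↦
    Integrable.of_bound (hm.comp (measurePreserving_comp_perm σ).measurable).aestronglyMeasurable
      C (Eventually.of_forall fun _ ↦ hg _)
  calc ∫ V : Fin n → UnitAddCircle, g (cyclicDescents (circleRep ∘ V))
      = 𝔼 σ : Equiv.Perm (Fin n),
          ∫ V : Fin n → UnitAddCircle, g (cyclicDescents (circleRep ∘ V ∘ σ)) := by
        simp only [hσ, Fintype.expect_const]
    _ = ∫ V : Fin n → UnitAddCircle, 𝔼 σ : Equiv.Perm (Fin n),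
          g (cyclicDescents (circleRep ∘ V ∘ σ)) := by
        simp only [Fintype.expect_eq_sum_div_card]
        rw [integral_div, integral_finsetSum _ fun σ _ ↦ hi σ]
    _ = ∫ _V : Fin n → UnitAddCircle, 𝔼 σ : Equiv.Perm (Fin n), g (cyclicDegree σ) := by
        refine integral_congr_ae ?_
        filter_upwards [ae_injective n] with V hV
        exact expect_cyclicDescents_comp (circleRep_injective.comp hV) g
    _ = _ := by simp

theorem sum_circleRep_cyclic_sub {n : ℕ} (V : Fin n → UnitAddCircle) :
    ∑ i, circleRep (V (finRotate n i) - V i) = cyclicDescents (circleRep ∘ V) := by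
  simp only [circleRep_sub, Finset.sum_add_distrib, Finset.sum_sub_distrib]
  rw [Equiv.sum_comp (finRotate n) fun i ↦ circleRep (V i), sub_self, zero_add, cyclicDescents,
    Finset.card_filter]
  push_cast
  rfl

/-- The two sums differ only by the wrap-around term, which lies in [0, 1). -/
theorem abs_cyclicDescents_sub_sum_le {m : ℕ} (V : Fin (m + 1) → UnitAddCircle) :
    |(cyclicDescents (circleRep ∘ V) : ℝ) - ∑ i, circleRep (consecutiveDiff m V i)| ≤ 1 := by
  rw [← sum_circleRep_cyclic_sub, Fin.sum_univ_castSucc]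
  simp only [finRotate_apply, Fin.coeSucc_eq_succ, Fin.last_add_one]
  have h := circleRep_mem (V 0 - V (Fin.last m))
  have hd : ∀ i, consecutiveDiff m V i = V i.succ - V i.castSucc := fun _ ↦ rfl
  simp only [hd, add_sub_cancel_left]
  rw [abs_of_nonneg h.1]
  exact h.2.le

end Circle

/-! ### The central limit theorem for the degree of a random `n`-cycle -/

section Assembly

open scoped BigOperators

theorem integral_uniformOn_univ {Ω : Type*} [Fintype Ω] [MeasurableSpace Ω]
    [MeasurableSingletonClass Ω] (f : Ω → ℝ) :
    ∫ ω, f ω ∂(uniformOn (Set.univ : Set Ω)) = 𝔼 ω, f ω := by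
  rw [uniformOn, ProbabilityTheory.cond, Measure.restrict_univ, integral_smul_measure, integral_count,
    Fintype.expect_eq_sum_div_card, Measure.count_univ]
  simp [div_eq_inv_mul]

theorem identDistrib_of_integral_indicator {Ω Ω' : Type*} [MeasurableSpace Ω] [MeasurableSpace Ω']
    {P : Measure Ω} {Q : Measure Ω'} [IsFiniteMeasure P] [IsFiniteMeasure Q]
    {X : Ω → ℝ} {Y : Ω' → ℝ} (hX : Measurable X) (hY : Measurable Y)
    (h : ∀ s : Set ℝ, MeasurableSet s →
      ∫ ω, s.indicator (1 : ℝ → ℝ) (X ω) ∂P = ∫ ω, s.indicator (1 : ℝ → ℝ) (Y ω) ∂Q) :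
    IdentDistrib X Y P Q := by
  refine ⟨hX.aemeasurable, hY.aemeasurable, ?_⟩
  ext s hs
  have key := h s hs
  have e1 : (fun ω ↦ s.indicator (1 : ℝ → ℝ) (X ω)) = (X ⁻¹' s).indicator 1 := rfl
  have e2 : (fun ω ↦ s.indicator (1 : ℝ → ℝ) (Y ω)) = (Y ⁻¹' s).indicator 1 := rfl
  rw [e1, e2, integral_indicator_one (hX hs), integral_indicator_one (hY hs)] at key
  rw [Measure.map_apply hX hs, Measure.map_apply hY hs]
  exact (measureReal_eq_measureReal_iff).1 key

theorem abs_indicator_one_le (s : Set ℝ) (x : ℝ) : |s.indicator (1 : ℝ → ℝ) x| ≤ 1 := by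
  by_cases h : x ∈ s <;> simp [h]

theorem memLp_cyclicDescents (n : ℕ) :
    MemLp (fun V : Fin n → UnitAddCircle ↦ (cyclicDescents (circleRep ∘ V) : ℝ)) 2 volume := by
  refine MemLp.of_bound
    (measurable_from_top.comp (measurable_cyclicDescents n)).aestronglyMeasurable n
    (Eventually.of_forall fun V ↦ ?_)
  rw [Real.norm_of_nonneg (Nat.cast_nonneg _)]
  exact_mod_cast (Finset.card_filter_le _ _).trans_eq (Finset.card_fin n)

theorem identDistrib_sum_consecutiveDiff (m : ℕ) :
    IdentDistrib (fun V : Fin (m + 1) → UnitAddCircle ↦ ∑ i, circleRep (consecutiveDiff m V i))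
      (fun u : Fin m → UnitAddCircle ↦ ∑ i, circleRep (u i)) volume volume := by
  have h := measurePreserving_consecutiveDiff m
  have hm : Measurable fun u : Fin m → UnitAddCircle ↦ ∑ i, circleRep (u i) := by fun_prop
  refine ⟨(hm.comp h.measurable).aemeasurable, hm.aemeasurable, ?_⟩
  conv_rhs => rw [← h.map_eq]
  rw [Measure.map_map hm h.measurable]
  rfl

theorem memLp_sum_consecutiveDiff (m : ℕ) :
    MemLp (fun V : Fin (m + 1) → UnitAddCircle ↦ ∑ i, circleRep (consecutiveDiff m V i)) 2
      volume := by
  refine MemLp.of_bound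
    (identDistrib_sum_consecutiveDiff m).aemeasurable_fst.aestronglyMeasurable m
    (Eventually.of_forall fun V ↦ ?_)
  refine (norm_sum_le_of_le Finset.univ (f := fun i ↦ circleRep (consecutiveDiff m V i))
    (n := fun _ ↦ (1 : ℝ)) fun i _ ↦ ?_).trans (by simp)
  rw [Real.norm_of_nonneg (circleRep_mem _).1]
  exact (circleRep_mem _).2.le

theorem sqrt_variance_sum_consecutiveDiff (m : ℕ) :
    √(variance (fun V : Fin (m + 1) → UnitAddCircle ↦
      ∑ i, circleRep (consecutiveDiff m V i)) volume) = √m * √(variance circleRep volume) := by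
  rw [(identDistrib_sum_consecutiveDiff m).variance_eq, variance_sum_circleRep,
    Real.sqrt_mul (Nat.cast_nonneg m)]

theorem sqrt_variance_cyclicDescents_sub_le (m : ℕ) :
    √(variance ((fun V : Fin (m + 1) → UnitAddCircle ↦ (cyclicDescents (circleRep ∘ V) : ℝ)) -
      fun V ↦ ∑ i, circleRep (consecutiveDiff m V i)) volume) ≤ 1 := by
  refine Real.sqrt_le_iff.2 ⟨zero_le_one, ?_⟩
  rw [one_pow]
  have hL := (memLp_cyclicDescents (m + 1)).sub (memLp_sum_consecutiveDiff m)
  refine (variance_le_expectation_sq hL.aestronglyMeasurable).trans ?_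
  refine (integral_mono_of_nonneg (Eventually.of_forall fun V ↦ sq_nonneg _)
    (integrable_const (1 : ℝ)) (Eventually.of_forall fun V ↦ ?_)).trans (by simp)
  exact (sq_le_one_iff_abs_le_one _).2 (abs_cyclicDescents_sub_sum_le V)

theorem tendsto_sqrt_natCast_atTop : Tendsto (fun m : ℕ ↦ √(m : ℝ)) atTop atTop :=
  Real.tendsto_sqrt_atTop.comp tendsto_natCast_atTop_atTop

theorem tendsto_stdCharFun_cyclicDescents (t : ℝ) :
    Tendsto (fun m : ℕ ↦ stdCharFun (volume : Measure (Fin (m + 1) → UnitAddCircle))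
      (fun V ↦ (cyclicDescents (circleRep ∘ V) : ℝ)) t) atTop
      (nhds (Complex.exp (-t ^ 2 / 2))) := by
  have hv : 0 < √(variance circleRep volume) := Real.sqrt_pos.2 variance_circleRep_pos
  refine tendsto_stdCharFun_of_variance_sub (fun m ↦ memLp_cyclicDescents (m + 1))
    memLp_sum_consecutiveDiff ?_ ?_ ?_
  · filter_upwards [eventually_gt_atTop 0] with m hm
    rw [sqrt_variance_sum_consecutiveDiff]
    positivity
  · refine squeeze_zero (g := fun m : ℕ ↦ 1 / (√m * √(variance circleRep volume)))
      (fun m ↦ by positivity) (fun m ↦ ?_) ?_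
    · rw [sqrt_variance_sum_consecutiveDiff]
      exact div_le_div_of_nonneg_right (sqrt_variance_cyclicDescents_sub_le m) (by positivity)
    · exact (tendsto_sqrt_natCast_atTop.atTop_mul_const hv).const_div_atTop 1
  · simp only [fun m ↦ stdCharFun_congr (identDistrib_sum_consecutiveDiff m) t]
    exact tendsto_stdCharFun_sum_circleRep t

theorem tendsto_sqrt_variance_cyclicDescents_div :
    Tendsto (fun m : ℕ ↦ √(variance (fun V : Fin (m + 1) → UnitAddCircle ↦
      (cyclicDescents (circleRep ∘ V) : ℝ)) volume) / √m) atTop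
      (nhds √(variance circleRep volume)) := by
  rw [tendsto_iff_norm_sub_tendsto_zero]
  refine squeeze_zero' (g := fun m : ℕ ↦ 1 / √m) (Eventually.of_forall fun _ ↦ norm_nonneg _) ?_
    (tendsto_sqrt_natCast_atTop.const_div_atTop 1)
  filter_upwards [eventually_gt_atTop 0] with m hm
  have hs : 0 < √(m : ℝ) := by positivity
  have h := (abs_sqrt_variance_sub_le (memLp_cyclicDescents (m + 1))
    (memLp_sum_consecutiveDiff m)).trans (sqrt_variance_cyclicDescents_sub_le m)
  rw [sqrt_variance_sum_consecutiveDiff] at h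
  rw [Real.norm_eq_abs, div_sub' hs.ne', abs_div, abs_of_pos hs]
  exact div_le_div_of_nonneg_right h hs.le

theorem tendsto_harmonic_div_sqrt :
    Tendsto (fun m : ℕ ↦ 4 * ((harmonic (m + 1) : ℝ) + 1) / √m) atTop (nhds 0) := by
  have hlog : Tendsto (fun m : ℕ ↦ Real.log m / √m) atTop (nhds 0) := by
    have h := (isLittleO_log_rpow_atTop (r := 1 / 2) (by norm_num)).tendsto_div_nhds_zero
    simpa only [Real.sqrt_eq_rpow, Function.comp_def] using h.comp tendsto_natCast_atTop_atTop
  -- The 12 comes from `harmonic (m + 1) ≤ 2 + log m`, so that the numerator is at most `4 * (3 +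
  -- log m)`.
  have hb : Tendsto (fun m : ℕ ↦ 12 / √m + 4 * (Real.log m / √m)) atTop (nhds 0) := by
    simpa using (tendsto_sqrt_natCast_atTop.const_div_atTop 12).add (hlog.const_mul 4)
  have hH : ∀ n : ℕ, (0 : ℝ) ≤ harmonic n := fun n ↦ by
    rw [harmonic]
    positivity
  refine squeeze_zero (fun m ↦ ?_) (fun m ↦ ?_) hb
  · have := hH (m + 1)
    positivity
  · have h1 := harmonic_le_one_add_log m
    have h2 : (harmonic (m + 1) : ℝ) ≤ harmonic m + 1 := by
      rw [harmonic_succ]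
      push_cast
      have : ((m : ℝ) + 1)⁻¹ ≤ 1 := inv_le_one_of_one_le₀ (by simp)
      linarith
    rw [← mul_div_assoc, ← add_div]
    exact div_le_div_of_nonneg_right (by linarith) (Real.sqrt_nonneg _)

theorem tendsto_stdCharFun_degreeRV (t : ℝ) :
    Tendsto (fun m : ℕ ↦ stdCharFun (uniformNCycle (m + 1)) (degreeRV (m + 1)) t) atTop
      (nhds (Complex.exp (-t ^ 2 / 2))) := by
  choose Ω hF hN s c hs hc _ hD using exists_coupling_perm_nCycle
  let _ : ∀ m, MeasurableSpace (Ω m) := fun _ ↦ ⊤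
  have : ∀ m, DiscreteMeasurableSpace (Ω m) := fun _ ↦ ⟨fun _ ↦ trivial⟩
  let P : ∀ m, Measure (Ω m) := fun m ↦ uniformOn Set.univ
  have : ∀ m, IsProbabilityMeasure (P m) := fun m ↦
    isProbabilityMeasure_uniformOn Set.finite_univ Set.univ_nonempty
  let X : ∀ m, Ω m → ℝ := fun m ω ↦ degreeRV (m + 1) (c m ω)
  let Y : ∀ m, Ω m → ℝ := fun m ω ↦ (cyclicDegree (s m ω) : ℝ)
  have hX : ∀ m, IdentDistrib (X m) (degreeRV (m + 1)) (P m) (uniformNCycle (m + 1)) := fun m ↦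
    identDistrib_of_integral_indicator .of_discrete .of_discrete fun A _ ↦ by
      rw [integral_uniformOn_univ, uniformNCycle, integral_uniformOn_univ]
      exact hc m fun ν ↦ A.indicator 1 (degreeRV (m + 1) ν)
  have hY : ∀ m, IdentDistrib (Y m) (fun V : Fin (m + 1) → UnitAddCircle ↦
      (cyclicDescents (circleRep ∘ V) : ℝ)) (P m) volume := fun m ↦
    identDistrib_of_integral_indicator .of_discrete
      (measurable_from_top.comp (measurable_cyclicDescents (m + 1))) fun A _ ↦ by
      rw [integral_uniformOn_univ, integral_cyclicDescents (m + 1)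
        (g := fun k ↦ A.indicator 1 (k : ℝ)) (C := 1) fun _ ↦ abs_indicator_one_le _ _]
      exact hs m fun σ ↦ A.indicator 1 (cyclicDegree σ : ℝ)
  have hXY : ∀ m, √(variance (X m - Y m) (P m)) ≤ 4 * (harmonic (m + 1) + 1) := by
    intro m
    have hH : (0 : ℝ) ≤ harmonic (m + 1) := by
      rw [harmonic]
      positivity
    refine Real.sqrt_le_iff.2 ⟨by positivity, ?_⟩
    refine (variance_le_expectation_sq Measurable.of_discrete.aestronglyMeasurable).trans ?_
    rw [integral_uniformOn_univ]
    calc 𝔼 ω, ((X m - Y m) ^ 2) ω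
        ≤ 𝔼 ω, 4 * (hammingDist (s m ω) (c m ω).1 : ℝ) ^ 2 := by
          refine Finset.expect_le_expect fun ω _ ↦ ?_
          have h := pow_le_pow_left₀ (abs_nonneg _)
            (abs_cyclicDegree_sub_le (s m ω) (c m ω).1) 2
          rw [sq_abs, mul_pow] at h
          norm_num at h
          exact h
      _ ≤ 4 * (4 * (harmonic (m + 1) + 1) ^ 2) := by
          rw [← Finset.mul_expect]
          exact mul_le_mul_of_nonneg_left (hD m) (by norm_num)
      _ = _ := by ring
  have hsd := tendsto_sqrt_variance_cyclicDescents_div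
  simp only [fun m ↦ ((hY m).variance_eq).symm] at hsd
  have hv : 0 < √(variance circleRep volume) := Real.sqrt_pos.2 variance_circleRep_pos
  -- The degree of the cycle and that of the permutation now live on the common space `Ω m`, where
  -- they can be subtracted.
  simp only [fun m ↦ (stdCharFun_congr (hX m) t).symm]
  refine tendsto_stdCharFun_of_variance_sub (fun m ↦ MemLp.of_discrete)
    (fun m ↦ MemLp.of_discrete) (Y := Y) ?_ ?_ ?_
  · filter_upwards [hsd.eventually (lt_mem_nhds hv)] with m hm
    by_contra hc
    rw [le_antisymm (not_lt.1 hc) (Real.sqrt_nonneg _), zero_div] at hm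
    exact lt_irrefl _ hm
  -- Numerator and denominator are both scaled by √m: the first tends to 0, the second to a positive
  -- constant.
  · have hq := tendsto_harmonic_div_sqrt.div hsd hv.ne'
    rw [zero_div] at hq
    refine squeeze_zero' (Eventually.of_forall fun m ↦ by positivity) ?_ hq
    filter_upwards [eventually_gt_atTop 0] with m hm
    have hsq : √(m : ℝ) ≠ 0 := by positivity
    simp only [Pi.div_apply]
    rw [div_div_div_cancel_right₀ hsq]
    exact div_le_div_of_nonneg_right (hXY m) (Real.sqrt_nonneg _)
  · simp only [fun m ↦ stdCharFun_congr (hY m) t]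
    exact tendsto_stdCharFun_cyclicDescents t

end Assembly

theorem mainTheorem3 :
    TendstoInDistribution normalizedDegree atTop (id : ℝ → ℝ) uniformNCycle (gaussianReal 0 1) := by
  refine ⟨fun _ ↦ Measurable.of_discrete.aemeasurable, measurable_id.aemeasurable, ?_⟩
  refine ProbabilityMeasure.tendsto_iff_tendsto_charFun.2 fun t ↦ ?_
  -- The coupling exists on `m + 1` points, so the index is shifted by one.
  refine (tendsto_add_atTop_iff_nat 1).1 ?_
  have h : Tendsto (fun m : ℕ ↦ charFun ((uniformNCycle (m + 1)).map
      (normalizedDegree (m + 1))) t) atTop (nhds (Complex.exp (-t ^ 2 / 2))) :=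
    tendsto_stdCharFun_degreeRV t
  simpa [charFun_gaussianReal, neg_div] using h
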